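/- Let $m\in\mathbf N_0=\{0,1,2,\ldots\}$ and $x\in[-1,1]$. For $\rho$ in the open unit disk $\mathbf D=\{z\in\mathbf C:|z|<1\}$ put $$R=R(\rho,x)=\sqrt{1+\rho^2-2\rho x},\qquad \zeta_\pm=\zeta_\pm(\rho,x)=\frac{1\pm\rho}{R},$$ with the principal branch of the square root. Let $T_n$ be the Chebyshev polynomial of the first kind, $(z)_k=\prod_{i=1}^{k}(z+i-1)$ the Pochhammer symbol, and $\epsilon_n=2-\delta_{n,0}$ the Neumann factor. Let $$P_\nu^\mu(z)=\frac{1}{\Gamma(1-\mu)}\Big(\frac{z+1}{z-1}\Big)^{\mu/2}{}_2F_1\Big(-\nu,\nu+1;1-\mu;\frac{1-z}{2}\Big),\qquad z\in\mathbf C\setminus(-\infty,1],$$ be the associated Legendre function of the first kind, and $$\mathrm P_\nu^\mu(t)=\frac{1}{\Gamma(1-\mu)}\Big(\frac{1+t}{1-t}\Big)^{\mu/2}{}_2F_1\Big(-\nu,\nu+1;1-\mu;\frac{1-t}{2}\Big),\qquad t\in(-1,1),$$ the Ferrers function of the first kind, where ${}_2F_1$ is the Gauss hypergeometric function, continued analytically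 from $\mathbf D$ to $\mathbf C\setminus[1,\infty)$, and powers are principal values. If $\rho\in\mathbf D\setminus(-1,0]$, then $$\frac{1}{R^{m}}\,T_m(\zeta_+)=\frac{1}{(1-\rho)^m}\sum_{n=0}^\infty\epsilon_n\,(m)_{2n}\,P_{-m}^{-2n}\Big(\frac{1+\rho}{1-\rho}\Big)\,T_n(x),$$ and if $\rho\in(0,1)$, then $$\frac{1}{R^{m}}\,T_m(\zeta_-)=\frac{1}{(1+\rho)^m}\sum_{n=0}^\infty\epsilon_n\,(m)_{2n}\,\mathrm P_{-m}^{-2n}\Big(\frac{1-\rho}{1+\rho}\Big)\,T_n(x),$$ where both series converge absolutely. -/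

import Mathlib

/-- `g` is the analytic continuation of the Gauss series `∑ (a)ₙ (b)ₙ / (c)ₙ zⁿ / n!` from the
open unit disk to the plane cut along `[1, ∞)`. -/
def IsGaussContinuation (a b c : ℂ) (g : ℂ → ℂ) : Prop :=
  AnalyticOnNhd ℂ g {z : ℂ | 1 - z ∈ Complex.slitPlane} ∧
    ∀ z ∈ Metric.ball (0 : ℂ) 1, g z = ₂F₁ a b c z

open Classical in
/-- The principal branch of the Gauss hypergeometric function on `ℂ ∖ [1, ∞)`: the value of the
(unique) analytic continuation of the Gauss series. -/
noncomputable def gauss2F1 (a b c z : ℂ) : ℂ :=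
  if h : ∃ g : ℂ → ℂ, IsGaussContinuation a b c g then h.choose z else 0

/-- The associated Legendre function of the first kind `P_ν^μ(z)`, for `z ∈ ℂ ∖ (-∞, 1]`. -/
noncomputable def legendreP (ν μ z : ℂ) : ℂ :=
  1 / Complex.Gamma (1 - μ) * ((z + 1) / (z - 1)) ^ (μ / 2) *
    gauss2F1 (-ν) (ν + 1) (1 - μ) ((1 - z) / 2)

/-- The Ferrers function of the first kind `P_ν^μ(x)`, for `x ∈ (-1, 1)`. -/
noncomputable def ferrersP (ν μ : ℂ) (x : ℝ) : ℂ :=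
  1 / Complex.Gamma (1 - μ) * (((1 + x) / (1 - x) : ℝ) : ℂ) ^ (μ / 2) *
    gauss2F1 (-ν) (ν + 1) (1 - μ) (((1 - x) / 2 : ℝ) : ℂ)

/-- The Pochhammer symbol `(z)ₙ = z (z + 1) ⋯ (z + n - 1)`. -/
noncomputable def pochhammerSymbol (z : ℂ) (n : ℕ) : ℂ :=
  ∏ i ∈ Finset.range n, (z + i)

/-- The Chebyshev polynomial of the first kind as a function on `ℂ`. -/
noncomputable def chebyT (n : ℕ) (z : ℂ) : ℂ :=
  (Polynomial.Chebyshev.T ℂ (n : ℤ)).eval z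

/-- The Neumann factor `εₙ = 2 - δ_{n,0}`. -/
def neumannFactor (n : ℕ) : ℕ := if n = 0 then 1 else 2

/-- `R(ρ, x) = √(1 + ρ² - 2ρx)` (principal branch). -/
noncomputable def radR (ρ : ℂ) (x : ℝ) : ℂ :=
  (1 + ρ ^ 2 - 2 * ρ * (x : ℂ)) ^ (1 / 2 : ℂ)

/-- `ζ₊(ρ, x) = (1 + ρ) / R(ρ, x)`. -/
noncomputable def zetaPlus (ρ : ℂ) (x : ℝ) : ℂ := (1 + ρ) / radR ρ x

/-- `ζ₋(ρ, x) = (1 - ρ) / R(ρ, x)`. -/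
noncomputable def zetaMinus (ρ : ℂ) (x : ℝ) : ℂ := (1 - ρ) / radR ρ x

/-! Write `ρ = s²`, `x = cos θ`, `u = s e^{iθ/2}`, `v = s e^{-iθ/2}`, so that `uv = ρ` and `R² = (1
- u²)(1 - v²)`. Then `R^{-m} T_m(ζ₊)` is the mean of `((1-u)(1-v))^{-m}` and `((1+u)(1+v))^{-m}`
(`chebyT_div_pow`). For `m = M + 1`, the binomial double series of this mean keeps only the
monomials `u^i v^j` with `i + j` even. Grouping them by `n = (i - j)/2`, the terms `±n` give `2 ρ^n
T_n(x)` (`hasSum_chebyT`), with a coefficient `∑_k C(k+M,M) C(k+2n+M,M) ρ^k`. Vandermonde turns this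
into a terminating `₂F₁` at `-ρ/(1-ρ)` (`hasSum_choose_mul_choose`), which is the Legendre function.
The Ferrers series is the same expansion at `(-ρ, -x)`. -/

open Polynomial in
theorem ascPochhammer_eval_succ_mul_factorial (k j : ℕ) :
    (ascPochhammer ℂ j).eval ((k : ℂ) + 1) * (k.factorial : ℂ) = ((k + j).factorial : ℂ) := by
  have h := ascPochhammer_nat_eq_natCast_ascFactorial ℂ (k + 1) j
  push_cast at h
  rw [h, mul_comm]
  exact_mod_cast Nat.factorial_mul_ascFactorial k j

open Polynomial in
theorem ascPochhammer_eval_neg_natCast (M j : ℕ) :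
    (ascPochhammer ℂ j).eval (-(M : ℂ)) = (-1) ^ j * ((j.factorial : ℂ) * (M.choose j : ℂ)) := by
  rw [ascPochhammer_eval_neg_eq_descPochhammer, descPochhammer_eval_eq_descFactorial,
    Nat.descFactorial_eq_factorial_mul_choose]
  push_cast
  ring

theorem pochhammerSymbol_eq_ascPochhammer (z : ℂ) (n : ℕ) :
    pochhammerSymbol z n = (ascPochhammer ℂ n).eval z := by
  induction n with
  | zero => simp [pochhammerSymbol]
  | succ n ih =>
    rw [ascPochhammer_succ_eval, ← ih]
    simp [pochhammerSymbol, Finset.prod_range_succ]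

/-- The truncated Gauss series. -/
noncomputable def gaussPolynomial (J : ℕ) (a b c z : ℂ) : ℂ :=
  ∑ j ∈ Finset.range J, ordinaryHypergeometricCoefficient a b c j * z ^ j

/-- A terminating series is its own continuation. The cut plane is connected, so by the identity
theorem the chosen continuation agrees with it. -/
theorem gauss2F1_eq_gaussPolynomial {J : ℕ} {a b c z : ℂ}
    (h : ∀ j, J ≤ j → ordinaryHypergeometricCoefficient a b c j = 0)
    (hz : 1 - z ∈ Complex.slitPlane) : gauss2F1 a b c z = gaussPolynomial J a b c z := by
  have hp : IsGaussContinuation a b c (gaussPolynomial J a b c) := by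
    constructor
    · have : Differentiable ℂ (gaussPolynomial J a b c) := by
        unfold gaussPolynomial
        fun_prop
      exact fun y _ => this.analyticAt y
    · intro y _
      rw [ordinaryHypergeometric_eq_tsum]
      refine (tsum_eq_sum (s := Finset.range J) fun j hj => ?_).symm
      have := h j (by simpa using hj)
      simp only [ordinaryHypergeometricCoefficient] at this
      simp [this]
  have hex : ∃ g : ℂ → ℂ, IsGaussContinuation a b c g := ⟨_, hp⟩
  rw [gauss2F1, dif_pos hex]
  have hg := hex.choose_spec
  have hconn : IsPreconnected {z : ℂ | 1 - z ∈ Complex.slitPlane} := by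
    have him : {z : ℂ | 1 - z ∈ Complex.slitPlane} = (fun z => 1 - z) '' Complex.slitPlane := by
      ext y
      simp only [Set.mem_ofPred_eq, Set.mem_image]
      exact ⟨fun hy => ⟨1 - y, hy, by ring⟩, by rintro ⟨w, hw, rfl⟩; simpa using hw⟩
    rw [him]
    exact (Complex.starConvex_one_slitPlane.isPathConnected
      Complex.one_mem_slitPlane).isConnected.isPreconnected.image _ (by fun_prop)
  refine hg.1.eqOn_of_preconnected_of_eventuallyEq hp.1 hconn
    (z₀ := 0) (by simp) ?_ hz
  filter_upwards [Metric.ball_mem_nhds (0 : ℂ) one_pos] with y hy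
  rw [hg.2 y hy, hp.2 y hy]

/-! ### The coefficient series as a terminating hypergeometric sum. -/

theorem hasSum_choose_mul_pow_shift {M j : ℕ} {ρ : ℂ} (hρ : ‖ρ‖ < 1) :
    HasSum (fun k : ℕ => ((M + k).choose (M + j) : ℂ) * ρ ^ k)
      (ρ ^ j * (1 / (1 - ρ) ^ (M + j + 1))) := by
  have h := (hasSum_choose_mul_geometric_of_norm_lt_one (M + j) hρ).mul_left (ρ ^ j)
  rw [← hasSum_nat_add_iff' j]
  have h0 : ∑ i ∈ Finset.range j, (((M + i).choose (M + j) : ℕ) : ℂ) * ρ ^ i = 0 := by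
    refine Finset.sum_eq_zero fun i hi => ?_
    rw [Nat.choose_eq_zero_of_lt (by have := Finset.mem_range.1 hi; lia)]
    simp
  rw [h0, sub_zero]
  refine h.congr_fun ?_ |> id
  intro k
  rw [show M + (k + j) = k + (M + j) by ring, pow_add]
  ring

/-- Vandermonde's convolution, after `C(k+N, N+j) = C(k+N, k-j)`. -/
theorem sum_choose_mul_choose_add (M N k : ℕ) :
    ∑ j ∈ Finset.range (M + 1), M.choose j * (k + N).choose (N + j) = (M + k + N).choose k := by
  rw [add_assoc, Nat.add_choose_eq,
    Finset.Nat.sum_antidiagonal_eq_sum_range_succ fun i j => M.choose i * (k + N).choose j]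
  have h1 : ∑ j ∈ Finset.range (M + 1), M.choose j * (k + N).choose (N + j) =
      ∑ j ∈ Finset.range (M + k + 1), M.choose j * (k + N).choose (N + j) := by
    refine Finset.sum_subset (by intro a; simp; lia) fun j _ hj => ?_
    rw [Nat.choose_eq_zero_of_lt (by simpa using hj), zero_mul]
  have h2 : ∑ j ∈ Finset.range (k + 1), M.choose j * (k + N).choose (N + j) =
      ∑ j ∈ Finset.range (M + k + 1), M.choose j * (k + N).choose (N + j) := by
    refine Finset.sum_subset (by intro a; simp; lia) fun j _ hj => ?_
    rw [Nat.choose_eq_zero_of_lt (n := k + N) (by simp at hj; lia), mul_zero]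
  rw [h1, ← h2]
  refine Finset.sum_congr rfl fun j hj => ?_
  have := Finset.mem_range.1 hj
  rw [Nat.choose_symm_of_eq_add (show k + N = (N + j) + (k - j) by lia)]

theorem hasSum_choose_mul_choose {M N : ℕ} {ρ : ℂ} (hρ : ‖ρ‖ < 1) :
    HasSum (fun k : ℕ => ((k + M).choose M : ℂ) * ((k + N + M).choose M : ℂ) * ρ ^ k)
      (pochhammerSymbol ((M + 1 : ℕ) : ℂ) N / (N.factorial : ℂ) * (1 / (1 - ρ) ^ (M + 1) *
        gaussPolynomial (M + 1) ((M : ℂ) + 1) (-(M : ℂ)) ((N : ℂ) + 1) (-ρ / (1 - ρ)))) := by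
  have hρ1 : 1 - ρ ≠ 0 := fun h => by
    rw [← sub_eq_zero.1 h] at hρ
    simp at hρ
  have hfac : ∀ n : ℕ, (n.factorial : ℂ) ≠ 0 := fun n => by exact_mod_cast n.factorial_ne_zero
  -- The weights turn `C(M+k, M+j)` into `C(M,j) C(k+N, N+j)` times a factor free of `j`, ready for
  -- Vandermonde.
  have h := hasSum_sum (s := Finset.range (M + 1)) fun j (_ : j ∈ Finset.range (M + 1)) =>
    (hasSum_choose_mul_pow_shift (M := M) (j := j) hρ).mul_left
      (((M + N).factorial : ℂ) * (M + j).factorial /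
        (M.factorial ^ 2 * (N + j).factorial) * M.choose j)
  convert! h using 1
  · funext k
    have hv := congrArg (Nat.cast : ℕ → ℂ) (sum_choose_mul_choose_add M N k)
    push_cast at hv
    have hterm : ∀ j, ((M + N).factorial : ℂ) * (M + j).factorial /
        (M.factorial ^ 2 * (N + j).factorial) * M.choose j *
          (((M + k).choose (M + j) : ℂ) * ρ ^ k) =
        ((M + N).factorial : ℂ) * (M + k).factorial / (M.factorial ^ 2 * (k + N).factorial) *
          ρ ^ k * (M.choose j * (k + N).choose (N + j)) := by
      intro j
      rcases le_or_gt j k with hjk | hjk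
      · obtain ⟨i, rfl⟩ := Nat.exists_eq_add_of_le hjk
        rw [show M + (j + i) = (M + j) + i by ring, show j + i + N = (N + j) + i by ring,
          Nat.cast_add_choose, Nat.cast_add_choose]
        field_simp [hfac]
      · rw [Nat.choose_eq_zero_of_lt (show M + k < M + j by lia),
          Nat.choose_eq_zero_of_lt (show k + N < N + j by lia)]
        simp
    rw [Finset.sum_congr rfl fun j _ => hterm j, ← Finset.mul_sum, hv,
      show M + k + N = k + (M + N) by ring, Nat.cast_add_choose, add_comm k M,
      Nat.cast_add_choose, show k + N + M = M + (k + N) by ring, Nat.cast_add_choose,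
      show k + (M + N) = M + (k + N) by ring]
    field_simp [hfac]
  · rw [gaussPolynomial, Finset.mul_sum, Finset.mul_sum]
    refine Finset.sum_congr rfl fun j _ => ?_
    have e1 : pochhammerSymbol ((M + 1 : ℕ) : ℂ) N = (M + N).factorial / M.factorial := by
      rw [eq_div_iff (hfac M), pochhammerSymbol_eq_ascPochhammer]
      push_cast
      exact ascPochhammer_eval_succ_mul_factorial M N
    have e2 := (eq_div_iff (hfac M)).2 (ascPochhammer_eval_succ_mul_factorial M j)
    have e3 := (eq_div_iff (hfac N)).2 (ascPochhammer_eval_succ_mul_factorial N j)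
    have hs : ((-1 : ℂ) ^ j) * (-1) ^ j = 1 := by rw [← mul_pow]; simp
    rw [e1, ordinaryHypergeometricCoefficient, e2, e3, ascPochhammer_eval_neg_natCast, div_pow,
      neg_pow ρ, show M + j + 1 = (M + 1) + j by ring, pow_add (1 - ρ)]
    field_simp [hfac]
    linear_combination (M.choose j : ℂ) * ρ ^ j * (1 - ρ) ^ (j + M + 1) * hs

/-! ### The generating function and its double series. -/

theorem chebyT_add_inv (n : ℕ) {y y' : ℂ} (h : y * y' = 1) :
    chebyT n ((y + y') / 2) = (y ^ n + y' ^ n) / 2 := by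
  induction n using Nat.twoStepInduction with
  | zero => simp [chebyT]
  | one => simp [chebyT]
  | more n ih1 ih2 =>
    simp only [chebyT] at ih1 ih2 ⊢
    push_cast at ih1 ih2 ⊢
    rw [Polynomial.Chebyshev.T_add_two]
    simp only [Polynomial.eval_sub, Polynomial.eval_mul, Polynomial.eval_X, Polynomial.eval_ofNat,
      ih1, ih2]
    linear_combination (y ^ n + y' ^ n) / 2 * h

theorem radR_sq (ρ : ℂ) (x : ℝ) : radR ρ x ^ 2 = 1 + ρ ^ 2 - 2 * ρ * (x : ℂ) := by
  rw [radR, ← Complex.cpow_nat_mul]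
  norm_num

/-- Closed form of the generating function in the roots `u`, `v` with `u v = ρ`. -/
theorem chebyT_div_pow {R u v : ℂ} (hR : R ^ 2 = (1 - u ^ 2) * (1 - v ^ 2)) (hR0 : R ≠ 0) (m : ℕ) :
    1 / R ^ m * chebyT m ((1 + u * v) / R) =
      (1 / (1 - u) ^ m * (1 / (1 - v) ^ m) + 1 / (1 + u) ^ m * (1 / (1 + v) ^ m)) / 2 := by
  have h0 : (1 - u) * (1 - v) * ((1 + u) * (1 + v)) ≠ 0 := by
    rw [show (1 - u) * (1 - v) * ((1 + u) * (1 + v)) = R ^ 2 by rw [hR]; ring]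
    exact pow_ne_zero 2 hR0
  have hu : 1 - u ≠ 0 := by rintro h; simp [h] at h0
  have hv : 1 - v ≠ 0 := by rintro h; simp [h] at h0
  have hu' : 1 + u ≠ 0 := by rintro h; simp [h] at h0
  have hv' : 1 + v ≠ 0 := by rintro h; simp [h] at h0
  -- These mutually inverse numbers have mean `(1 + uv)/R`, so `chebyT_add_inv` applies.
  have hy : (1 + u) * (1 + v) / R * ((1 - u) * (1 - v) / R) = 1 := by
    field_simp
    rw [hR]
    ring
  rw [show (1 + u * v) / R = ((1 + u) * (1 + v) / R + (1 - u) * (1 - v) / R) / 2 by ring,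
    chebyT_add_inv m hy]
  have hRm : R ^ m * R ^ m = (1 - u) ^ m * (1 - v) ^ m * ((1 + u) ^ m * (1 + v) ^ m) := by
    rw [← mul_pow, ← mul_pow, ← mul_pow, ← mul_pow, ← sq, hR]
    ring
  rw [div_pow, div_pow, mul_pow, mul_pow]
  field_simp
  rw [sq, hRm]
  ring

theorem hasSum_mul_complex {f g : ℕ → ℂ} {a b : ℂ} (hf : HasSum f a) (hg : HasSum g b) :
    HasSum (fun p : ℕ × ℕ => f p.1 * g p.2) (a * b) :=
  hf.mul hg (summable_mul_of_summable_norm hf.summable.norm hg.summable.norm)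

/-- Averaging over `(u, v) ↦ (-u, -v)` kills the exponents `(i, j)` of odd sum. The others are
parametrized by `n = (i - j)/2 ∈ ℤ` and `k = min i j`. -/
theorem hasSum_pow_int {M : ℕ} {u v : ℂ} (hu : ‖u‖ < 1) (hv : ‖v‖ < 1) :
    HasSum (fun p : ℤ × ℕ => ((p.2 + 2 * p.1.toNat + M).choose M : ℂ) * u ^ (p.2 + 2 * p.1.toNat) *
        (((p.2 + 2 * (-p.1).toNat + M).choose M : ℂ) * v ^ (p.2 + 2 * (-p.1).toNat)))
      ((1 / (1 - u) ^ (M + 1) * (1 / (1 - v) ^ (M + 1)) +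
        1 / (1 + u) ^ (M + 1) * (1 / (1 + v) ^ (M + 1))) / 2) := by
  have key : ∀ {u v : ℂ}, ‖u‖ < 1 → ‖v‖ < 1 →
      HasSum (fun p : ℕ × ℕ => ((p.1 + M).choose M : ℂ) * u ^ p.1 *
        (((p.2 + M).choose M : ℂ) * v ^ p.2))
        (1 / (1 - u) ^ (M + 1) * (1 / (1 - v) ^ (M + 1))) := by
    intro u v hu hv
    have h1 := hasSum_choose_mul_geometric_of_norm_lt_one M hu
    have h2 := hasSum_choose_mul_geometric_of_norm_lt_one M hv
    have h3 := hasSum_mul_complex h1 h2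
    simpa only using h3
  have hneg := key (u := -u) (v := -v) (by rwa [norm_neg]) (by rwa [norm_neg])
  have h := ((key hu hv).add hneg).div_const 2
  simp only [sub_neg_eq_add] at h
  let e : ℤ × ℕ → ℕ × ℕ := fun p => (p.2 + 2 * p.1.toNat, p.2 + 2 * (-p.1).toNat)
  have he : Function.Injective e := by
    rintro ⟨n, k⟩ ⟨n', k'⟩ h
    simp only [e, Prod.mk.injEq] at h ⊢
    lia
  rw [← he.hasSum_iff] at h
  · refine h.congr_fun fun p => ?_
    have hs : (-1 : ℂ) ^ (p.2 + 2 * p.1.toNat) * (-1) ^ (p.2 + 2 * (-p.1).toNat) = 1 := by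
      rw [← pow_add]
      exact Even.neg_one_pow ⟨p.2 + p.1.toNat + (-p.1).toNat, by ring⟩
    obtain ⟨n, k⟩ := p
    simp only [Function.comp_apply, e] at hs ⊢
    generalize k + 2 * n.toNat = i at hs ⊢
    generalize k + 2 * (-n).toNat = j at hs ⊢
    rw [neg_pow u, neg_pow v]
    linear_combination (-((i + M).choose M : ℂ) * u ^ i * (((j + M).choose M : ℂ) * v ^ j) / 2) * hs
  · rintro ⟨i, j⟩ hij
    have hodd : Odd (i + j) := by
      by_contra hc
      rw [Nat.not_odd_iff_even] at hc
      obtain ⟨t, ht⟩ := hc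
      apply hij
      refine ⟨((i : ℤ) - t, min i j), ?_⟩
      simp only [e, Prod.mk.injEq]
      lia
    have hs : (-1 : ℂ) ^ i * (-1) ^ j = -1 := by rw [← pow_add, hodd.neg_one_pow]
    dsimp only
    rw [neg_pow u, neg_pow v]
    linear_combination ((i + M).choose M : ℂ) * u ^ i * (((j + M).choose M : ℂ) * v ^ j) / 2 * hs

theorem hasSum_chebyT {M : ℕ} {ρ : ℂ} (hρ : ‖ρ‖ < 1) {x : ℝ} (hx : x ∈ Set.Icc (-1 : ℝ) 1)
    {A : ℕ → ℂ} (hA : ∀ n : ℕ, HasSum (fun k : ℕ =>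
      ((k + M).choose M : ℂ) * ((k + 2 * n + M).choose M : ℂ) * ρ ^ k) (A n)) :
    HasSum (fun n : ℕ => (neumannFactor n : ℂ) * (A n * ρ ^ n) * chebyT n (x : ℂ))
      (1 / radR ρ x ^ (M + 1) * chebyT (M + 1) (zetaPlus ρ x)) := by
  obtain ⟨s, hs⟩ := IsSquare.exists_sq (a := ρ) (Complex.isSquare ρ)
  set w : ℂ := Complex.exp ((Real.arccos x / 2 : ℝ) * Complex.I) with hw
  have hw1 : ‖w‖ = 1 := Complex.norm_exp_ofReal_mul_I _
  have hw0 : w ≠ 0 := Complex.exp_ne_zero _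
  have hs1 : ‖s‖ < 1 := by
    rw [hs, norm_pow] at hρ
    exact (sq_lt_one_iff₀ (norm_nonneg s)).1 hρ
  have hxw : (x : ℂ) = (w ^ 2 + w⁻¹ ^ 2) / 2 := by
    have h : (x : ℂ) = Complex.cos (Real.arccos x) := by
      rw [← Complex.ofReal_cos, Real.cos_arccos hx.1 hx.2]
    rw [h, Complex.cos, hw, ← Complex.exp_neg, ← Complex.exp_nat_mul, ← Complex.exp_nat_mul]
    push_cast
    ring_nf
  have hww : w * w⁻¹ = 1 := mul_inv_cancel₀ hw0
  obtain ⟨u, hu⟩ : ∃ u, u = s * w := ⟨_, rfl⟩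
  obtain ⟨v, hv⟩ : ∃ v, v = s * w⁻¹ := ⟨_, rfl⟩
  have huv : u * v = ρ := by rw [hs, hu, hv]; linear_combination s ^ 2 * hww
  have hun : ‖u‖ < 1 := by rw [hu, norm_mul, hw1, mul_one]; exact hs1
  have hvn : ‖v‖ < 1 := by rw [hv, norm_mul, norm_inv, hw1, inv_one, mul_one]; exact hs1
  have hsq : ∀ {z : ℂ}, ‖z‖ < 1 → 1 - z ^ 2 ≠ 0 := by
    intro z hz h
    have h1 : ‖z ^ 2‖ < 1 := by
      rw [norm_pow]
      exact (sq_lt_one_iff₀ (norm_nonneg z)).2 hz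
    rw [← sub_eq_zero.1 h] at h1
    simp at h1
  have hR : radR ρ x ^ 2 = (1 - u ^ 2) * (1 - v ^ 2) := by
    rw [radR_sq, hxw, hs, hu, hv]
    linear_combination (-s ^ 4 * (w * w⁻¹ + 1)) * hww
  have hR0 : radR ρ x ≠ 0 := fun h => by
    rw [h, zero_pow two_ne_zero] at hR
    exact mul_ne_zero (hsq hun) (hsq hvn) hR.symm
  rw [zetaPlus, ← huv, chebyT_div_pow (by rw [huv]; exact hR) (by rw [huv]; exact hR0)]
  rw [huv]
  let G : ℤ → ℂ := fun n => A n.natAbs * (u ^ (2 * n.toNat) * v ^ (2 * (-n).toNat))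
  have hG := (hasSum_pow_int (M := M) hun hvn).prod_fiberwise (g := G) (by
    intro n
    refine ((hA n.natAbs).mul_right _).congr_fun fun k => ?_
    rw [← huv, mul_pow]
    rcases le_total 0 n with h | h
    · have h1 : n.natAbs = n.toNat := by lia
      have h2 : (-n).toNat = 0 := by lia
      simp only [h1, h2]
      ring_nf
    · have h1 : n.natAbs = (-n).toNat := by lia
      have h2 : n.toNat = 0 := by lia
      simp only [h1, h2]
      ring_nf)
  -- Folding `ℤ` onto `ℕ` counts `n = 0` twice; removing one copy produces the Neumann factor.
  have hN := hG.nat_add_neg.sub (hasSum_ite_eq (0 : ℕ) (G 0))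
  rw [add_sub_cancel_right] at hN
  refine hN.congr_fun fun n => ?_
  have hT : chebyT n (x : ℂ) = ((w ^ 2) ^ n + (w⁻¹ ^ 2) ^ n) / 2 := by
    rw [hxw]
    exact chebyT_add_inv n (by rw [← mul_pow, hww, one_pow])
  have h1 : ρ ^ n * (w ^ 2) ^ n = u ^ (2 * n) := by
    rw [hs, hu, pow_mul, mul_pow s w 2, mul_pow]
  have h2 : ρ ^ n * (w⁻¹ ^ 2) ^ n = v ^ (2 * n) := by
    rw [hs, hv, pow_mul, mul_pow s _ 2, mul_pow]
  rcases Nat.eq_zero_or_pos n with rfl | hn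
  · simp [neumannFactor, G, chebyT]
  · rw [hT]
    simp only [neumannFactor, G, hn.ne', if_false]
    have h3 : (-(n : ℤ)).toNat = 0 := by lia
    simp only [Int.natAbs_neg, Int.natAbs_natCast, Int.toNat_natCast, h3, neg_neg, mul_zero,
      pow_zero]
    push_cast
    linear_combination (A n) * (h1 + h2)

/-! ### Translation to Legendre and Ferrers functions. -/

theorem one_sub_mem_slitPlane {ρ : ℂ} (hρ : ‖ρ‖ < 1) :
    1 - -ρ / (1 - ρ) ∈ Complex.slitPlane := by
  have h : 0 < (1 - ρ).re := by
    have := Complex.re_le_norm ρ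
    simp only [Complex.sub_re, Complex.one_re]
    linarith
  have h0 : 1 - ρ ≠ 0 := fun h' => by simp [h'] at h
  rw [show 1 - -ρ / (1 - ρ) = (1 - ρ)⁻¹ by field_simp; ring]
  left
  rw [Complex.inv_re]
  exact div_pos h (Complex.normSq_pos.2 h0)

theorem gauss2F1_succ_neg (M N : ℕ) {z : ℂ} (hz : 1 - z ∈ Complex.slitPlane) :
    gauss2F1 ((M : ℂ) + 1) (-(M : ℂ)) ((N : ℂ) + 1) z =
      gaussPolynomial (M + 1) ((M : ℂ) + 1) (-(M : ℂ)) ((N : ℂ) + 1) z := by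
  refine gauss2F1_eq_gaussPolynomial (fun j hj => ?_) hz
  rw [ordinaryHypergeometricCoefficient, ascPochhammer_eval_neg_natCast,
    Nat.choose_eq_zero_of_lt hj]
  simp

theorem gauss2F1_zero_left (b c : ℂ) {z : ℂ} (hz : 1 - z ∈ Complex.slitPlane) :
    gauss2F1 0 b c z = 1 := by
  rw [gauss2F1_eq_gaussPolynomial (J := 1) (fun j hj => ?_) hz]
  · simp [gaussPolynomial, ordinaryHypergeometricCoefficient]
  · rw [ordinaryHypergeometricCoefficient, ascPochhammer_eval_zero, if_neg (by lia)]
    simp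

/-- At order `μ = -2n` the exponent `μ/2` is an integer, so no branch of the power enters. -/
theorem inv_cpow_neg_natCast (ρ : ℂ) (n : ℕ) : (ρ⁻¹) ^ (-(2 * (n : ℂ)) / 2) = ρ ^ n := by
  rw [show -(2 * (n : ℂ)) / 2 = -(n : ℂ) by ring, Complex.cpow_neg, Complex.cpow_natCast]
  simp

theorem Gamma_one_sub_neg_two_mul (n : ℕ) :
    Complex.Gamma (1 - -(2 * (n : ℂ))) = ((2 * n).factorial : ℂ) := by
  rw [← Complex.Gamma_nat_eq_factorial]
  congr 1
  push_cast
  ring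

theorem legendreP_argument {ρ : ℂ} (hρ : ‖ρ‖ < 1) :
    ((1 + ρ) / (1 - ρ) + 1) / ((1 + ρ) / (1 - ρ) - 1) = ρ⁻¹ ∧
      (1 - (1 + ρ) / (1 - ρ)) / 2 = -ρ / (1 - ρ) := by
  have h0 : 1 - ρ ≠ 0 := fun h => by
    rw [← sub_eq_zero.1 h] at hρ
    simp at hρ
  constructor
  · rw [show (1 + ρ) / (1 - ρ) + 1 = 2 / (1 - ρ) by field_simp; ring,
      show (1 + ρ) / (1 - ρ) - 1 = 2 * ρ / (1 - ρ) by field_simp; ring,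
      div_div_div_cancel_right₀ h0, div_mul_cancel_left₀ two_ne_zero]
  · field_simp
    ring

theorem legendreP_eq {ρ : ℂ} (hρ : ‖ρ‖ < 1) (ν : ℂ) (n : ℕ) :
    legendreP ν (-(2 * (n : ℂ))) ((1 + ρ) / (1 - ρ)) =
      1 / ((2 * n).factorial : ℂ) * ρ ^ n *
        gauss2F1 (-ν) (ν + 1) (((2 * n : ℕ) : ℂ) + 1) (-ρ / (1 - ρ)) := by
  obtain ⟨h1, h2⟩ := legendreP_argument hρ
  rw [legendreP, h1, h2, inv_cpow_neg_natCast, Gamma_one_sub_neg_two_mul]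
  congr 2
  push_cast
  ring

theorem ferrersP_eq {ρ : ℝ} (hρ : ρ ∈ Set.Ioo (0 : ℝ) 1) (ν : ℂ) (n : ℕ) :
    ferrersP ν (-(2 * (n : ℂ))) ((1 - ρ) / (1 + ρ)) =
      1 / ((2 * n).factorial : ℂ) * (ρ : ℂ) ^ n *
        gauss2F1 (-ν) (ν + 1) (((2 * n : ℕ) : ℂ) + 1) (-(-(ρ : ℂ)) / (1 - -(ρ : ℂ))) := by
  have hρ0 := hρ.1
  have h1 : (1 + (1 - ρ) / (1 + ρ)) / (1 - (1 - ρ) / (1 + ρ)) = ρ⁻¹ := by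
    rw [show 1 + (1 - ρ) / (1 + ρ) = 2 / (1 + ρ) by field_simp; ring,
      show 1 - (1 - ρ) / (1 + ρ) = 2 * ρ / (1 + ρ) by field_simp; ring]
    field_simp
  have h2 : (1 - (1 - ρ) / (1 + ρ)) / 2 = ρ / (1 + ρ) := by
    field_simp
    ring
  rw [ferrersP, h1, h2, Complex.ofReal_inv, inv_cpow_neg_natCast, Gamma_one_sub_neg_two_mul]
  congr 2 <;> push_cast <;> ring

/-- The case `m = 0`, outside the binomial argument with `m = M + 1`: `(0)_{2n}` vanishes for `n >
0`. -/
theorem hasSum_neumann_zero {P : ℕ → ℂ} (hP : P 0 = 1) (x : ℂ) :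
    HasSum (fun n : ℕ => (neumannFactor n : ℂ) * pochhammerSymbol ((0 : ℕ) : ℂ) (2 * n) *
      P n * chebyT n x) 1 := by
  have h := hasSum_single (f := fun n : ℕ => (neumannFactor n : ℂ) *
    pochhammerSymbol ((0 : ℕ) : ℂ) (2 * n) * P n * chebyT n x) 0 fun n hn => by
      rw [pochhammerSymbol_eq_ascPochhammer, Nat.cast_zero, ascPochhammer_eval_zero,
        if_neg (by lia)]
      simp
  convert! h using 1
  simp [neumannFactor, pochhammerSymbol, hP, chebyT]

/-- The common expansion behind the Legendre and Ferrers series. -/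
theorem hasSum_gauss2F1 (m : ℕ) {x : ℝ} (hx : x ∈ Set.Icc (-1 : ℝ) 1) {ρ : ℂ} (hρ : ‖ρ‖ < 1) :
    HasSum (fun n : ℕ => 1 / (1 - ρ) ^ m *
      ((neumannFactor n : ℂ) * pochhammerSymbol (m : ℂ) (2 * n) *
        (1 / ((2 * n).factorial : ℂ) * ρ ^ n *
          gauss2F1 (-(-(m : ℂ))) (-(m : ℂ) + 1) (((2 * n : ℕ) : ℂ) + 1) (-ρ / (1 - ρ))) *
        chebyT n (x : ℂ)))
      (1 / radR ρ x ^ m * chebyT m (zetaPlus ρ x)) := by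
  rcases m with _ | M
  · have h := hasSum_neumann_zero (P := fun n => 1 / ((2 * n).factorial : ℂ) * ρ ^ n *
      gauss2F1 (-(-((0 : ℕ) : ℂ))) (-((0 : ℕ) : ℂ) + 1) (((2 * n : ℕ) : ℂ) + 1)
        (-ρ / (1 - ρ))) (by simp [gauss2F1_zero_left _ _ (one_sub_mem_slitPlane hρ)]) (x : ℂ)
    simpa [chebyT] using h
  · refine (hasSum_chebyT hρ hx fun n => hasSum_choose_mul_choose (N := 2 * n) hρ).congr_fun
      fun n => ?_
    rw [← gauss2F1_succ_neg M (2 * n) (one_sub_mem_slitPlane hρ)]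
    rw [show (-(-((M + 1 : ℕ) : ℂ))) = (M : ℂ) + 1 by push_cast; ring,
      show (-((M + 1 : ℕ) : ℂ) + 1) = -(M : ℂ) by push_cast; ring]
    ring

theorem chebyT_neg (n : ℕ) (z : ℂ) : chebyT n (-z) = (-1) ^ n * chebyT n z := by
  simp [chebyT, Polynomial.Chebyshev.T_eval_neg, Int.negOnePow_def]

theorem mainTheorem9 (m : ℕ) (x : ℝ) (hx : x ∈ Set.Icc (-1 : ℝ) 1) :
    (∀ ρ : ℂ, ρ ∈ Metric.ball (0 : ℂ) 1 \ (Complex.ofReal '' Set.Ioc (-1 : ℝ) 0) →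
      Summable (fun n : ℕ => (neumannFactor n : ℂ) * pochhammerSymbol (m : ℂ) (2 * n) *
        legendreP (-(m : ℂ)) (-(2 * (n : ℂ))) ((1 + ρ) / (1 - ρ)) * chebyT n (x : ℂ)) ∧
      1 / radR ρ x ^ m * chebyT m (zetaPlus ρ x) =
        1 / (1 - ρ) ^ m *
          ∑' n : ℕ, (neumannFactor n : ℂ) * pochhammerSymbol (m : ℂ) (2 * n) *
            legendreP (-(m : ℂ)) (-(2 * (n : ℂ))) ((1 + ρ) / (1 - ρ)) * chebyT n (x : ℂ)) ∧
    (∀ ρ : ℝ, ρ ∈ Set.Ioo (0 : ℝ) 1 →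
      Summable (fun n : ℕ => (neumannFactor n : ℂ) * pochhammerSymbol (m : ℂ) (2 * n) *
        ferrersP (-(m : ℂ)) (-(2 * (n : ℂ))) ((1 - ρ) / (1 + ρ)) * chebyT n (x : ℂ)) ∧
      1 / radR (ρ : ℂ) x ^ m * chebyT m (zetaMinus (ρ : ℂ) x) =
        1 / (1 + (ρ : ℂ)) ^ m *
          ∑' n : ℕ, (neumannFactor n : ℂ) * pochhammerSymbol (m : ℂ) (2 * n) *
            ferrersP (-(m : ℂ)) (-(2 * (n : ℂ))) ((1 - ρ) / (1 + ρ)) * chebyT n (x : ℂ)) := by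
  -- A nonzero prefactor can be dropped from summability, which in `ℂ` is absolute convergence.
  have hne : ∀ {ρ : ℂ}, ‖ρ‖ < 1 → 1 / (1 - ρ) ^ m ≠ 0 := by
    intro ρ hρ
    refine one_div_ne_zero (pow_ne_zero m fun h => ?_)
    rw [← sub_eq_zero.1 h] at hρ
    simp at hρ
  constructor
  · rintro ρ ⟨hρ, -⟩
    rw [mem_ball_zero_iff] at hρ
    have h := hasSum_gauss2F1 m hx hρ
    simp only [← legendreP_eq hρ] at h
    exact ⟨(summable_mul_left_iff (hne hρ)).1 h.summable, by rw [← tsum_mul_left, h.tsum_eq]⟩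
  · intro ρ hρ
    have hρ' : ‖-(ρ : ℂ)‖ < 1 := by
      rw [norm_neg, Complex.norm_real, Real.norm_of_nonneg hρ.1.le]
      exact hρ.2
    -- Under `(ρ, x) ↦ (-ρ, -x)`, `R` is fixed, `ζ₊` becomes `ζ₋`, and the signs from `ρ^n` and
    -- `T_n` cancel.
    have h := hasSum_gauss2F1 m (x := -x) ⟨by linarith [hx.2], by linarith [hx.1]⟩ hρ'
    have hR : radR (-(ρ : ℂ)) (-x) = radR ρ x := by
      simp [radR]
    have hZ : zetaPlus (-(ρ : ℂ)) (-x) = zetaMinus ρ x := by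
      rw [zetaPlus, zetaMinus, hR, ← sub_eq_add_neg]
    have hterm : ∀ n : ℕ, (neumannFactor n : ℂ) * pochhammerSymbol (m : ℂ) (2 * n) *
        (1 / ((2 * n).factorial : ℂ) * (-(ρ : ℂ)) ^ n *
          gauss2F1 (-(-(m : ℂ))) (-(m : ℂ) + 1) (((2 * n : ℕ) : ℂ) + 1)
            (-(-(ρ : ℂ)) / (1 - -(ρ : ℂ)))) * chebyT n ((-x : ℝ) : ℂ) =
        (neumannFactor n : ℂ) * pochhammerSymbol (m : ℂ) (2 * n) *
          ferrersP (-(m : ℂ)) (-(2 * (n : ℂ))) ((1 - ρ) / (1 + ρ)) * chebyT n (x : ℂ) := by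
      intro n
      have hs : ((-1 : ℂ) ^ n) * (-1) ^ n = 1 := by rw [← mul_pow]; simp
      rw [ferrersP_eq hρ, Complex.ofReal_neg, chebyT_neg, neg_pow (ρ : ℂ)]
      generalize gauss2F1 _ _ _ _ = g
      linear_combination (neumannFactor n : ℂ) * pochhammerSymbol (m : ℂ) (2 * n) *
        (1 / ((2 * n).factorial : ℂ) * (ρ : ℂ) ^ n * g) * chebyT n (x : ℂ) * hs
    simp only [hterm, hR, hZ] at h
    have hc := hne hρ'
    rw [sub_neg_eq_add] at h hc
    exact ⟨(summable_mul_left_iff hc).1 h.summable, by rw [← tsum_mul_left, h.tsum_eq]⟩
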